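/- Let $0<\tau<L$. For a convex set $\mathcal B\subset\mathbb R^n$ with nonempty interior, let $\mathcal F_{\tau,L,\mathcal B}$ be the class of differentiable functions $f:\mathcal B\to\mathbb R$ that satisfy $f(y)\ge f(x)+\langle\nabla f(x),y-x\rangle+\frac{\tau}{2}\|x-y\|^2$ and $\|\nabla f(x)-\nabla f(y)\|\le L\|x-y\|$ for all $x,y\in\mathcal B$ (Euclidean norm), and that attain their minimum over $\mathcal B$ at a point $x_f^*\in\mathcal B$. A function evaluation oracle for $f$ with variance $\sigma^2$ answers a query $x\in\mathcal B$ with $E_f(x)=f(x)+w$, where $w$ is drawn, independently of everything else, from a law on $\mathbb R$ with $\mathbb E[w]=0$ and $\mathbb E[w^2]=\sigma^2$. There is a constant $c>0$, depending only on $\tau$ and $L$ (in particular not on $T$ or $n$), such that for every $n\ge 8$, every convex $\mathcal B\subset\mathbb R^n$ with nonempty interior, every $\sigma>0$, and all sufficiently large $T$ (how large may depend on $\tau,L,n,\mathcal B,\sigma$), $$\inf_{\widehat x_T}\ \sup_{f,\,E_f}\ \mathbb E\left[f(\widehat x_T)-f(x_f^*)\right]\ \ge\ c\left(\frac{n\sigma^2}{T}\right)^{1/2}.$$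 Here the infimum is over all (adaptive, possibly randomized) methods that make $T$ queries to the oracle at points of $\mathcal B$ and output an estimate $\widehat x_T\in\mathcal B$; the supremum is over all $f\in\mathcal F_{\tau,L,\mathcal B}$ and all function evaluation oracles for $f$ with variance $\sigma^2$; and the expectation is over the noise and the randomization of the method. -/

import Mathlib

open MeasureTheory Filter

universe u

noncomputable section

namespace DFO

/-- `f` has a gradient at every point of `B` (relative to `B`, so only the values of `f` on `B`
matter) and is strongly convex on `B` with constant `τ > 0`. -/
structure StronglyConvexWith {n : ℕ} (τ : ℝ) (f : EuclideanSpace ℝ (Fin n) → ℝ)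
    (B : Set (EuclideanSpace ℝ (Fin n))) : Prop where
  pos : 0 < τ
  differentiableOn : DifferentiableOn ℝ f B
  lower_bound : ∀ x ∈ B, ∀ y ∈ B,
    f x + inner ℝ (gradientWithin f B x) (y - x) + τ / 2 * ‖x - y‖ ^ 2 ≤ f y

/-- The gradient of `f` is Lipschitz on `B` with constant `L > 0`. -/
structure LipschitzGradientWith {n : ℕ} (L : ℝ) (f : EuclideanSpace ℝ (Fin n) → ℝ)
    (B : Set (EuclideanSpace ℝ (Fin n))) : Prop where
  pos : 0 < L
  lipschitz : ∀ x ∈ B, ∀ y ∈ B,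
    ‖gradientWithin f B x - gradientWithin f B y‖ ≤ L * ‖x - y‖

/-- The class of strongly convex functions with Lipschitz gradients on `B`, with parameters
`τ` and `L`, which take their minimum over `B` at a point of `B`. -/
def functionClass {n : ℕ} (τ L : ℝ) (B : Set (EuclideanSpace ℝ (Fin n))) :
    Set (EuclideanSpace ℝ (Fin n) → ℝ) :=
  {f | StronglyConvexWith τ f B ∧ LipschitzGradientWith L f B ∧ ∃ x ∈ B, IsMinOn f B x}

/-- `ν` is the law of the additive noise of a function evaluation oracle with variance `σ²`:
a square-integrable law on `ℝ` with mean zero and second moment `σ²`. -/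
structure IsNoiseLaw (σ : ℝ) (ν : Measure ℝ) : Prop where
  isProbabilityMeasure : IsProbabilityMeasure ν
  memLp : MemLp id 2 ν
  mean : ∫ w, w ∂ν = 0
  second_moment : ∫ w, w ^ 2 ∂ν = σ ^ 2

/-- A (possibly randomized, adaptive) derivative-free method making `T` queries in `B`.
It first draws a random seed. The `k`-th query point is a measurable function of the seed and of
the `k` answers received before (the earlier query points are functions of these as well).
After `T` answers it outputs an estimate of the minimizer in `B`. -/
structure Method {n : ℕ} (B : Set (EuclideanSpace ℝ (Fin n))) (T : ℕ) where
  Seed : Type u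
  [measurableSpace : MeasurableSpace Seed]
  seedLaw : Measure Seed
  [isProbabilityMeasure : IsProbabilityMeasure seedLaw]
  query : ∀ k : Fin T, Seed × (Fin (k : ℕ) → ℝ) → B
  measurable_query : ∀ k, Measurable (query k)
  output : Seed × (Fin T → ℝ) → B
  measurable_output : Measurable output

attribute [instance] Method.measurableSpace Method.isProbabilityMeasure

/-- The first `k` answers of the oracle: the `j`-th answer is `f (x_j) + w_j`, where `x_j` is the
`j`-th query point and `w_j` the `j`-th noise variable. -/
def Method.answers {n : ℕ} {B : Set (EuclideanSpace ℝ (Fin n))} {T : ℕ} (A : Method B T)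
    (f : EuclideanSpace ℝ (Fin n) → ℝ) (s : A.Seed) (w : Fin T → ℝ) :
    (k : ℕ) → k ≤ T → (Fin k → ℝ)
  | 0, _ => Fin.elim0
  | k + 1, h =>
    Fin.snoc (α := fun _ => ℝ) (A.answers f s w k (Nat.le_of_succ_le h))
      (f (A.query ⟨k, h⟩ (s, A.answers f s w k (Nat.le_of_succ_le h))) + w ⟨k, h⟩)

/-- The estimate produced by the method run on `f` with seed `s` and noise sequence `w`. -/
def Method.estimate {n : ℕ} {B : Set (EuclideanSpace ℝ (Fin n))} {T : ℕ} (A : Method B T)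
    (f : EuclideanSpace ℝ (Fin n) → ℝ) (s : A.Seed) (w : Fin T → ℝ) :
    EuclideanSpace ℝ (Fin n) :=
  A.output (s, A.answers f s w T le_rfl)

/-- The expected error `𝔼 [f (x̂_T) - f (x_f^*)]`, with values in `[0, ∞]`. The noise variables are
independent with law `ν`, and independent of the seed. For `f` in the function class the infimum
of `f` over `B` is its minimum `f (x_f^*)`. -/
def Method.expectedError {n : ℕ} {B : Set (EuclideanSpace ℝ (Fin n))} {T : ℕ} (A : Method B T)
    (f : EuclideanSpace ℝ (Fin n) → ℝ) (ν : Measure ℝ) : ENNReal :=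
  ∫⁻ p, ENNReal.ofReal (f (A.estimate f p.1 p.2) - sInf (f '' B))
    ∂(A.seedLaw.prod (Measure.pi fun _ : Fin T => ν))

/-- The minimax error: infimum over all methods with `T` queries, supremum over all functions of
the class and all function evaluation oracles with variance `σ²`. -/
def minimaxError {n : ℕ} (τ L σ : ℝ) (B : Set (EuclideanSpace ℝ (Fin n))) (T : ℕ) : ENNReal :=
  ⨅ A : Method.{u} B T, ⨆ f ∈ functionClass τ L B, ⨆ (ν : Measure ℝ) (_ : IsNoiseLaw σ ν),
    A.expectedError f ν

end DFO

end

noncomputable section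

/-! Hide the minimizer in one of `2 ^ n` directions. To a quadratic at an interior point `x₀` of `B`
add a sine ridge of scale `r` along a sign vector `u`. The ridge has height `κ * r ^ 2` and
curvature at most `κ`, so strong convexity and smoothness survive uniformly in `r`, yet it moves the
minimizer by a distance `r * (κ / μ)` of order `r`. Missing the minimizer by half that distance
therefore costs an error of order `r ^ 2`, the same order as the height that the queries must
detect.

With Gaussian noise, replacing a hard function by the plain quadratic changes probabilities by at
most a second-moment factor: `P_b(E)² ≤ exp (T Δ² / σ²) P_g(E)` with `Δ = κ * r ^ 2`, even for
adaptive queries (`Method.sq_lintegral_prefixAnswers_le`). Under the quadratic the estimate carries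
no information on `b`, and any point is close to at most a fraction `exp (-3n/8)` of the sign
vectors (`card_norm_sub_signVector_lt_le`). Choosing `r` with `T Δ² / σ² = n/8`, Cauchy–Schwarz over
`b` bounds the average success probability by `exp (-n/8) ≤ 1/2`. So some hard function has error at
least half the gap, which is of order `r ^ 2`, that is, of order `σ √(n/T)`. -/

theorem Real.sin_le_tangent_add_sq (x y : ℝ) :
    Real.sin y ≤ Real.sin x + Real.cos x * (y - x) + (y - x) ^ 2 / 2 := by
  set h : ℝ → ℝ := fun t => Real.sin x + Real.cos x * (t - x) + (t - x) ^ 2 / 2 - Real.sin t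
  set h' : ℝ → ℝ := fun t => Real.cos x + (t - x) - Real.cos t
  have hd : ∀ t, HasDerivAt h (h' t) t := by
    intro t
    have h1 : HasDerivAt (fun t : ℝ => t - x) 1 t := (hasDerivAt_id t).sub_const x
    have := (((h1.const_mul (Real.cos x)).const_add (Real.sin x)).add
      ((h1.pow 2).div_const 2)).sub (Real.hasDerivAt_sin t)
    convert! this using 1
    simp [h']
  have hc : Continuous h := continuous_iff_continuousAt.2 fun t => (hd t).continuousAt
  have hx : h x = 0 := by simp [h]
  suffices 0 ≤ h y by simp only [h] at this; linarith
  rcases lt_trichotomy x y with hxy | rfl | hxy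
  -- As cosine is 1-Lipschitz, `h' t` has the sign of `t - x`, so `h` is minimal at `x`; the mean
  -- value theorem gives this on either side.
  · obtain ⟨c, hc, e⟩ := exists_hasDerivAt_eq_slope h h' hxy hc.continuousOn fun t _ => hd t
    have h2 := (abs_le.1 (Real.abs_cos_sub_cos_le x c)).1
    rw [abs_of_nonpos (by linarith [hc.1])] at h2
    have h3 : 0 ≤ h' c := by simp only [h']; linarith
    rw [eq_div_iff (by linarith), hx] at e
    nlinarith [mul_nonneg h3 (sub_nonneg.2 hxy.le)]
  · exact hx.ge
  · obtain ⟨c, hc, e⟩ := exists_hasDerivAt_eq_slope h h' hxy hc.continuousOn fun t _ => hd t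
    have h2 := (abs_le.1 (Real.abs_cos_sub_cos_le x c)).2
    rw [abs_of_nonneg (by linarith [hc.2])] at h2
    have h3 : h' c ≤ 0 := by simp only [h']; linarith
    rw [eq_div_iff (by linarith), hx] at e
    nlinarith [mul_nonneg (neg_nonneg.2 h3) (sub_nonneg.2 hxy.le)]

namespace DFO

/-! ### The hard functions -/

section TiltedQuadratic

variable {n : ℕ} {μ κ r : ℝ} {x₀ u : EuclideanSpace ℝ (Fin n)}

/-- A quadratic centred at `x₀`, perturbed by a bounded ridge function in direction `u` at
scale `r`. For `‖u‖ = 1` and `0 < r` its minimizer is `x₀ + (r * (κ / μ)) • u`. -/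
def tiltedQuadratic (μ κ r : ℝ) (x₀ u x : EuclideanSpace ℝ (Fin n)) : ℝ :=
  μ / 2 * ‖x - x₀‖ ^ 2 - κ * r ^ 2 * Real.sin (inner ℝ u (x - x₀) / r - κ / μ)

/-- The gradient of `tiltedQuadratic`. -/
def tiltedQuadraticGrad (μ κ r : ℝ) (x₀ u x : EuclideanSpace ℝ (Fin n)) :
    EuclideanSpace ℝ (Fin n) :=
  μ • (x - x₀) - (κ * r * Real.cos (inner ℝ u (x - x₀) / r - κ / μ)) • u

theorem hasGradientAt_tiltedQuadratic (hr : r ≠ 0) (x : EuclideanSpace ℝ (Fin n)) :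
    HasGradientAt (tiltedQuadratic μ κ r x₀ u) (tiltedQuadraticGrad μ κ r x₀ u x) x := by
  rw [hasGradientAt_iff_hasFDerivAt]
  have h1 : HasFDerivAt (fun y : EuclideanSpace ℝ (Fin n) => y - x₀)
      (ContinuousLinearMap.id ℝ _) x := (hasFDerivAt_id x).sub_const x₀
  have h2 := (h1.norm_sq).const_mul (μ / 2)
  have h3 := ((((innerSL ℝ u).hasFDerivAt.comp x h1).mul_const r⁻¹).sub_const (κ / μ)).sin
  have h4 := h2.sub (h3.const_mul (κ * r ^ 2))
  convert! h4 using 1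
  ext y
  simp only [tiltedQuadraticGrad, InnerProductSpace.toDual_apply_apply, inner_sub_left,
    real_inner_smul_left]
  simp
  simp only [div_eq_mul_inv]
  field_simp

theorem continuous_tiltedQuadratic : Continuous (tiltedQuadratic μ κ r x₀ u) := by
  unfold tiltedQuadratic
  fun_prop

theorem tiltedQuadratic_lower_bound (hκ : 0 ≤ κ) (hr : r ≠ 0) (hu : ‖u‖ = 1)
    (x y : EuclideanSpace ℝ (Fin n)) :
    tiltedQuadratic μ κ r x₀ u x + inner ℝ (tiltedQuadraticGrad μ κ r x₀ u x) (y - x) +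
      (μ - κ) / 2 * ‖x - y‖ ^ 2 ≤ tiltedQuadratic μ κ r x₀ u y := by
  obtain ⟨a, rfl⟩ : ∃ a, x = x₀ + a := ⟨x - x₀, by abel⟩
  obtain ⟨d, rfl⟩ : ∃ d, y = x₀ + a + d := ⟨y - (x₀ + a), by abel⟩
  have e1 : x₀ + a - x₀ = a := by abel
  have e2 : x₀ + a + d - x₀ = a + d := by abel
  have e3 : x₀ + a + d - (x₀ + a) = d := by abel
  have e4 : ‖x₀ + a - (x₀ + a + d)‖ = ‖d‖ := by rw [← norm_neg]; congr 1; abel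
  simp only [tiltedQuadratic, tiltedQuadraticGrad, e1, e2, e3, e4, inner_sub_left,
    real_inner_smul_left, norm_add_sq_real, inner_add_right]
  have hs := Real.sin_le_tangent_add_sq (inner ℝ u a / r - κ / μ)
    ((inner ℝ u a + inner ℝ u d) / r - κ / μ)
  have e5 : (inner ℝ u a + inner ℝ u d) / r - κ / μ - (inner ℝ u a / r - κ / μ) =
      inner ℝ u d / r := by ring
  rw [e5] at hs
  have hc : inner ℝ u d ^ 2 ≤ ‖d‖ ^ 2 := by
    have := abs_real_inner_le_norm u d
    rw [hu, one_mul] at this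
    exact sq_le_sq' (abs_le.1 this).1 (abs_le.1 this).2
  have h1 := mul_le_mul_of_nonneg_left hs (mul_nonneg hκ (sq_nonneg r))
  have h2 : κ * r ^ 2 * (Real.sin (inner ℝ u a / r - κ / μ) +
      Real.cos (inner ℝ u a / r - κ / μ) * (inner ℝ u d / r) + (inner ℝ u d / r) ^ 2 / 2) =
      κ * r ^ 2 * Real.sin (inner ℝ u a / r - κ / μ) +
      κ * r * Real.cos (inner ℝ u a / r - κ / μ) * inner ℝ u d + κ / 2 * inner ℝ u d ^ 2 := by
    field_simp
  rw [h2] at h1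
  have h3 := mul_le_mul_of_nonneg_left hc (div_nonneg hκ zero_le_two)
  linarith

theorem tiltedQuadraticGrad_lipschitz (hμ : 0 ≤ μ) (hκ : 0 ≤ κ) (hr : 0 < r) (hu : ‖u‖ = 1)
    (x y : EuclideanSpace ℝ (Fin n)) :
    ‖tiltedQuadraticGrad μ κ r x₀ u x - tiltedQuadraticGrad μ κ r x₀ u y‖ ≤
      (μ + κ) * ‖x - y‖ := by
  set a := inner ℝ u (x - x₀) / r - κ / μ
  set b := inner ℝ u (y - x₀) / r - κ / μ
  have e : tiltedQuadraticGrad μ κ r x₀ u x - tiltedQuadraticGrad μ κ r x₀ u y =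
      μ • (x - y) - (κ * r * (Real.cos a - Real.cos b)) • u := by
    simp only [tiltedQuadraticGrad, a, b]
    module
  have hab : |a - b| ≤ ‖x - y‖ / r := by
    have : a - b = inner ℝ u (x - y) / r := by
      simp only [a, b, inner_sub_right]; ring
    rw [this, abs_div, abs_of_pos hr]
    gcongr
    simpa [hu] using abs_real_inner_le_norm u (x - y)
  calc _ ≤ ‖μ • (x - y)‖ + ‖(κ * r * (Real.cos a - Real.cos b)) • u‖ := e ▸ norm_sub_le _ _
    _ = μ * ‖x - y‖ + κ * r * |Real.cos a - Real.cos b| := by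
        rw [norm_smul, norm_smul, hu, Real.norm_eq_abs, Real.norm_eq_abs, abs_mul, abs_mul,
          abs_of_nonneg hμ, abs_of_nonneg hκ, abs_of_pos hr, mul_one]
    _ ≤ μ * ‖x - y‖ + κ * r * (‖x - y‖ / r) := by
        gcongr
        exact (Real.abs_cos_sub_cos_le a b).trans hab
    _ = _ := by field_simp

/-- The phase `κ / μ` in the sine is chosen so that the cosine equals 1 here, which makes the
critical point explicit. -/
theorem tiltedQuadraticGrad_minimizer (hμ : μ ≠ 0) (hr : r ≠ 0) (hu : ‖u‖ = 1) :
    tiltedQuadraticGrad μ κ r x₀ u (x₀ + (r * (κ / μ)) • u) = 0 := by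
  have : inner ℝ u (x₀ + (r * (κ / μ)) • u - x₀) / r - κ / μ = 0 := by
    rw [add_sub_cancel_left, real_inner_smul_right, real_inner_self_eq_norm_sq, hu]
    field_simp
    ring
  rw [tiltedQuadraticGrad, this, add_sub_cancel_left, Real.cos_zero, smul_smul, ← sub_smul]
  rw [show μ * (r * (κ / μ)) - κ * r * 1 = 0 by field_simp; ring, zero_smul]

theorem tiltedQuadratic_quadratic_growth (hμ : μ ≠ 0) (hκ : 0 ≤ κ) (hr : r ≠ 0) (hu : ‖u‖ = 1)
    (x : EuclideanSpace ℝ (Fin n)) :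
    tiltedQuadratic μ κ r x₀ u (x₀ + (r * (κ / μ)) • u) +
      (μ - κ) / 2 * ‖x - (x₀ + (r * (κ / μ)) • u)‖ ^ 2 ≤ tiltedQuadratic μ κ r x₀ u x := by
  have := tiltedQuadratic_lower_bound (μ := μ) (x₀ := x₀) hκ hr hu (x₀ + (r * (κ / μ)) • u) x
  rwa [tiltedQuadraticGrad_minimizer hμ hr hu, inner_zero_left, add_zero, norm_sub_rev] at this

theorem abs_tiltedQuadratic_sub_le (hκ : 0 ≤ κ) (x : EuclideanSpace ℝ (Fin n)) :
    |tiltedQuadratic μ κ r x₀ u x - μ / 2 * ‖x - x₀‖ ^ 2| ≤ κ * r ^ 2 := by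
  rw [tiltedQuadratic, sub_sub_cancel_left, abs_neg, abs_mul, abs_of_nonneg (by positivity)]
  exact mul_le_of_le_one_right (by positivity) (Real.abs_sin_le_one _)

variable {B : Set (EuclideanSpace ℝ (Fin n))}

theorem isMinOn_tiltedQuadratic (hκ : 0 ≤ κ) (hκμ : κ < μ) (hr : r ≠ 0) (hu : ‖u‖ = 1) :
    IsMinOn (tiltedQuadratic μ κ r x₀ u) B (x₀ + (r * (κ / μ)) • u) := by
  intro x _
  have := tiltedQuadratic_quadratic_growth (x₀ := x₀) (hκ.trans_lt hκμ).ne' hκ hr hu x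
  have h2 : 0 ≤ (μ - κ) / 2 * ‖x - (x₀ + (r * (κ / μ)) • u)‖ ^ 2 :=
    mul_nonneg (by linarith) (sq_nonneg _)
  exact (le_add_of_nonneg_right h2).trans this

theorem tiltedQuadratic_mem_functionClass (hκ : 0 ≤ κ) (hκμ : κ < μ) (hr : 0 < r) (hu : ‖u‖ = 1)
    (hB : Convex ℝ B) (hBi : (interior B).Nonempty) (hmem : x₀ + (r * (κ / μ)) • u ∈ B) :
    tiltedQuadratic μ κ r x₀ u ∈ functionClass (μ - κ) (μ + κ) B := by
  have hμ : 0 < μ := hκ.trans_lt hκμ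
  -- A convex set with nonempty interior has unique derivatives, also at its boundary points.
  have hg : ∀ x ∈ B, gradientWithin (tiltedQuadratic μ κ r x₀ u) B x =
      tiltedQuadraticGrad μ κ r x₀ u x := by
    intro x hx
    have h := (hasGradientAt_tiltedQuadratic (μ := μ) (κ := κ) (x₀ := x₀) (u := u) hr.ne' x)
    rw [hasGradientAt_iff_hasFDerivAt] at h
    rw [gradientWithin, h.hasFDerivWithinAt.fderivWithin (uniqueDiffOn_convex hB hBi x hx)]
    simp
  refine ⟨⟨by linarith, ?_, ?_⟩, ⟨by linarith, ?_⟩, _, hmem,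
    isMinOn_tiltedQuadratic hκ hκμ hr.ne' hu⟩
  · exact fun x _ => (hasGradientAt_tiltedQuadratic hr.ne' x).differentiableAt.differentiableWithinAt
  · intro x hx y _
    rw [hg x hx]
    exact tiltedQuadratic_lower_bound hκ hr.ne' hu x y
  · intro x hx y hy
    rw [hg x hx, hg y hy]
    exact tiltedQuadraticGrad_lipschitz hμ.le hκ hr hu x y

theorem tiltedQuadratic_sub_sInf_ge (hκ : 0 ≤ κ) (hκμ : κ < μ) (hr : r ≠ 0) (hu : ‖u‖ = 1)
    (hmem : x₀ + (r * (κ / μ)) • u ∈ B) (x : EuclideanSpace ℝ (Fin n)) :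
    (μ - κ) / 2 * ‖x - (x₀ + (r * (κ / μ)) • u)‖ ^ 2 ≤
      tiltedQuadratic μ κ r x₀ u x - sInf (tiltedQuadratic μ κ r x₀ u '' B) := by
  have h := tiltedQuadratic_quadratic_growth (x₀ := x₀) (hκ.trans_lt hκμ).ne' hκ hr hu x
  have h2 : sInf (tiltedQuadratic μ κ r x₀ u '' B) ≤
      tiltedQuadratic μ κ r x₀ u (x₀ + (r * (κ / μ)) • u) :=
    csInf_le ⟨_, by
      rintro _ ⟨z, hz, rfl⟩
      exact isMinOn_tiltedQuadratic hκ hκμ hr hu hz⟩ ⟨_, hmem, rfl⟩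
  linarith

end TiltedQuadratic

end DFO

/-! ### Gaussian change of measure -/

open ProbabilityTheory in
-- Completing the square: `p₁² / p₂` is again a Gaussian density up to a constant, and that constant
-- is the second moment of the likelihood ratio.
theorem gaussianPDF_sq_eq (m₁ m₂ : ℝ) {v : NNReal} (hv : v ≠ 0) (x : ℝ) :
    gaussianPDF m₁ v x ^ 2 = gaussianPDF m₂ v x *
      (ENNReal.ofReal (Real.exp ((m₁ - m₂) ^ 2 / v)) * gaussianPDF (2 * m₁ - m₂) v x) := by
  have hv' : (v : ℝ) ≠ 0 := by exact_mod_cast hv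
  simp only [gaussianPDF]
  rw [← ENNReal.ofReal_pow (gaussianPDFReal_nonneg _ _ _), ← ENNReal.ofReal_mul (Real.exp_pos _).le,
    ← ENNReal.ofReal_mul (gaussianPDFReal_nonneg _ _ _)]
  congr 1
  simp only [gaussianPDFReal, mul_pow]
  have : Real.exp (-(x - m₁) ^ 2 / (2 * v)) ^ 2 = Real.exp (-(x - m₂) ^ 2 / (2 * v)) *
      (Real.exp ((m₁ - m₂) ^ 2 / v) * Real.exp (-(x - (2 * m₁ - m₂)) ^ 2 / (2 * v))) := by
    rw [sq, ← Real.exp_add, ← Real.exp_add, ← Real.exp_add]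
    congr 1
    field_simp
    ring
  rw [this]
  ring

open ProbabilityTheory in
/-- Change of measure between two Gaussian laws with the same variance, in second-moment form. -/
theorem sq_lintegral_gaussianReal_le (m₁ m₂ : ℝ) {v : NNReal} (hv : v ≠ 0) {h : ℝ → ENNReal}
    (hh : Measurable h) :
    (∫⁻ x, h x ∂gaussianReal m₁ v) ^ 2 ≤
      ENNReal.ofReal (Real.exp ((m₁ - m₂) ^ 2 / v)) * ∫⁻ x, h x ^ 2 ∂gaussianReal m₂ v := by
  rw [gaussianReal_of_var_ne_zero _ hv, gaussianReal_of_var_ne_zero _ hv,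
    lintegral_withDensity_eq_lintegral_mul _ (measurable_gaussianPDF _ _) hh,
    lintegral_withDensity_eq_lintegral_mul _ (measurable_gaussianPDF _ _) (hh.pow_const 2)]
  set C := ENNReal.ofReal (Real.exp ((m₁ - m₂) ^ 2 / v))
  have hF : Measurable (gaussianPDF m₂ v * fun x => h x ^ 2) :=
    (measurable_gaussianPDF _ _).mul (hh.pow_const 2)
  have hG : Measurable fun x => C * gaussianPDF (2 * m₁ - m₂) v x :=
    (measurable_gaussianPDF _ _).const_mul _
  -- Cauchy–Schwarz for `p₁ h = √(p₂ h²) √(p₁² / p₂)`.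
  have key := ENNReal.lintegral_mul_norm_pow_le (μ := volume) hF.aemeasurable hG.aemeasurable
    (p := 1 / 2) (q := 1 / 2) (by norm_num) (by norm_num) (by norm_num)
  have e : ∀ x, (gaussianPDF m₂ v * fun x => h x ^ 2) x ^ (1 / 2 : ℝ) *
      (C * gaussianPDF (2 * m₁ - m₂) v x) ^ (1 / 2 : ℝ) = (gaussianPDF m₁ v * h) x := by
    intro x
    rw [← ENNReal.mul_rpow_of_nonneg _ _ (by norm_num)]
    have : (gaussianPDF m₂ v * fun x => h x ^ 2) x * (C * gaussianPDF (2 * m₁ - m₂) v x) =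
        ((gaussianPDF m₁ v * h) x) ^ (2 : ℝ) := by
      rw [ENNReal.rpow_two, Pi.mul_apply, Pi.mul_apply, mul_pow, gaussianPDF_sq_eq m₁ m₂ hv]
      ring
    rw [this, ← ENNReal.rpow_mul]
    norm_num
  simp only [e] at key
  rw [lintegral_const_mul _ (measurable_gaussianPDF _ _), lintegral_gaussianPDF_eq_one _ hv,
    mul_one, ← ENNReal.mul_rpow_of_nonneg _ _ (by norm_num)] at key
  calc _ ≤ _ := pow_le_pow_left' key 2
    _ = _ := by
      rw [← ENNReal.rpow_two, ← ENNReal.rpow_mul, mul_comm]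
      norm_num

open ProbabilityTheory in
-- The form for a single oracle answer; the factor depends only on `Δ`, hence not on the query
-- point.
theorem sq_lintegral_add_gaussianReal_le {m₁ m₂ Δ : ℝ} (hΔ : |m₁ - m₂| ≤ Δ) {v : NNReal}
    (hv : v ≠ 0) {h : ℝ → ENNReal} (hh : Measurable h) :
    (∫⁻ w, h (m₁ + w) ∂gaussianReal 0 v) ^ 2 ≤
      ENNReal.ofReal (Real.exp (Δ ^ 2 / v)) * ∫⁻ w, h (m₂ + w) ^ 2 ∂gaussianReal 0 v := by
  have e : ∀ (m : ℝ) {g : ℝ → ENNReal}, Measurable g →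
      ∫⁻ w, g (m + w) ∂gaussianReal 0 v = ∫⁻ w, g w ∂gaussianReal m v := by
    intro m g hg
    have := gaussianReal_map_const_add (μ := 0) (v := v) m
    rw [zero_add] at this
    rw [← this, lintegral_map hg (measurable_const_add m)]
  rw [e m₁ hh, e m₂ (hh.pow_const 2)]
  refine (sq_lintegral_gaussianReal_le m₁ m₂ hv hh).trans ?_
  have := sq_le_sq' (abs_le.1 hΔ).1 (abs_le.1 hΔ).2
  gcongr ENNReal.ofReal (Real.exp (?_ / _)) * _

theorem measurable_finSnoc (k : ℕ) :
    Measurable fun p : (Fin k → ℝ) × ℝ => (Fin.snoc p.1 p.2 : Fin (k + 1) → ℝ) := by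
  refine measurable_pi_iff.2 fun i => ?_
  induction i using Fin.lastCases with
  | last => simpa using measurable_snd
  | cast j => simpa using! (measurable_pi_apply j).comp measurable_fst

theorem lintegral_pi_finSnoc {k : ℕ} (ν : Measure ℝ) [IsProbabilityMeasure ν]
    {G : (Fin (k + 1) → ℝ) → ENNReal} (hG : Measurable G) :
    ∫⁻ w, G w ∂Measure.pi (fun _ => ν) =
      ∫⁻ w, ∫⁻ t, G (Fin.snoc w t) ∂ν ∂Measure.pi (fun _ => ν) := by
  have h := (measurePreserving_piFinSuccAbove (fun _ : Fin (k + 1) => ν) (Fin.last k)).symm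
  rw [← h.lintegral_comp hG, lintegral_prod_symm']
  · refine lintegral_congr fun w => lintegral_congr fun t => ?_
    congr 1
    exact Fin.insertNth_last' t w
  · exact hG.comp h.measurable

/-! ### Laws of the answers of an adaptive method -/

namespace DFO

variable {n : ℕ} {B : Set (EuclideanSpace ℝ (Fin n))} {T : ℕ} (A : Method.{u} B T)

/-- The first `k` answers as a function of the first `k` noise variables only. -/
def Method.prefixAnswers (f : EuclideanSpace ℝ (Fin n) → ℝ) (s : A.Seed) :
    (k : ℕ) → k ≤ T → (Fin k → ℝ) → (Fin k → ℝ)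
  | 0, _, _ => Fin.elim0
  | k + 1, h, w =>
    Fin.snoc (α := fun _ => ℝ) (prefixAnswers f s k (Nat.le_of_succ_le h) (Fin.init w))
      (f (A.query ⟨k, h⟩ (s, prefixAnswers f s k (Nat.le_of_succ_le h) (Fin.init w))) +
        w (Fin.last k))

theorem Method.answers_eq_prefixAnswers (f : EuclideanSpace ℝ (Fin n) → ℝ) (s : A.Seed)
    (w : Fin T → ℝ) (k : ℕ) (h : k ≤ T) :
    A.answers f s w k h = A.prefixAnswers f s k h (fun i => w (Fin.castLE h i)) := by
  induction k with
  | zero => rfl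
  | succ k ih =>
    rw [Method.answers, Method.prefixAnswers, ih (Nat.le_of_succ_le h)]
    rfl

theorem Method.prefixAnswers_snoc (f : EuclideanSpace ℝ (Fin n) → ℝ) (s : A.Seed) (k : ℕ)
    (h : k + 1 ≤ T) (w : Fin k → ℝ) (t : ℝ) :
    A.prefixAnswers f s (k + 1) h (Fin.snoc w t) =
      Fin.snoc (A.prefixAnswers f s k (Nat.le_of_succ_le h) w)
        (f (A.query ⟨k, h⟩ (s, A.prefixAnswers f s k (Nat.le_of_succ_le h) w)) + t) := by
  simp [Method.prefixAnswers, Fin.init_snoc]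

theorem Method.measurable_prefixAnswers {f : EuclideanSpace ℝ (Fin n) → ℝ} (hf : Measurable f)
    (k : ℕ) (h : k ≤ T) :
    Measurable fun p : A.Seed × (Fin k → ℝ) => A.prefixAnswers f p.1 k h p.2 := by
  induction k with
  | zero => exact measurable_pi_iff.2 fun i => i.elim0
  | succ k ih =>
    have h1 : Measurable fun p : A.Seed × (Fin (k + 1) → ℝ) =>
        A.prefixAnswers f p.1 k (Nat.le_of_succ_le h) (Fin.init p.2) :=
      (ih (Nat.le_of_succ_le h)).comp (measurable_fst.prodMk
        (measurable_pi_iff.2 fun i => (measurable_pi_apply i.castSucc).comp measurable_snd))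
    have h2 : Measurable fun p : A.Seed × (Fin (k + 1) → ℝ) =>
        f (A.query ⟨k, h⟩ (p.1, A.prefixAnswers f p.1 k (Nat.le_of_succ_le h) (Fin.init p.2))) +
          p.2 (Fin.last k) :=
      (hf.comp (measurable_subtype_coe.comp
        ((A.measurable_query ⟨k, h⟩).comp (measurable_fst.prodMk h1)))).add
        ((measurable_pi_apply _).comp measurable_snd)
    exact (measurable_finSnoc k).comp (h1.prodMk h2)

theorem Method.measurable_estimate {f : EuclideanSpace ℝ (Fin n) → ℝ} (hf : Measurable f) :
    Measurable fun p : A.Seed × (Fin T → ℝ) => A.estimate f p.1 p.2 := by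
  refine measurable_subtype_coe.comp (A.measurable_output.comp (measurable_fst.prodMk ?_))
  simp only [A.answers_eq_prefixAnswers]
  exact A.measurable_prefixAnswers hf T le_rfl

open ProbabilityTheory in
/-- Change of measure between the laws of the answers for two functions that are uniformly close
to each other, in second-moment form. -/
theorem Method.sq_lintegral_prefixAnswers_le {f g : EuclideanSpace ℝ (Fin n) → ℝ}
    (hf : Measurable f) (hg : Measurable g) {Δ : ℝ} (hfg : ∀ x, |f x - g x| ≤ Δ) {v : NNReal}
    (hv : v ≠ 0) (s : A.Seed) (k : ℕ) (h : k ≤ T) {G : (Fin k → ℝ) → ENNReal}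
    (hG : Measurable G) :
    (∫⁻ w, G (A.prefixAnswers f s k h w) ∂Measure.pi fun _ => gaussianReal 0 v) ^ 2 ≤
      ENNReal.ofReal (Real.exp (Δ ^ 2 / v)) ^ k *
        ∫⁻ w, G (A.prefixAnswers g s k h w) ^ 2 ∂Measure.pi fun _ => gaussianReal 0 v := by
  induction k with
  | zero => simp [Method.prefixAnswers]
  | succ k ih =>
    set C := ENNReal.ofReal (Real.exp (Δ ^ 2 / v))
    have hk := Nat.le_of_succ_le h
    have hp : ∀ {f : EuclideanSpace ℝ (Fin n) → ℝ}, Measurable f →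
        Measurable (A.prefixAnswers f s (k + 1) h) := fun hf =>
      (A.measurable_prefixAnswers hf (k + 1) h).comp measurable_prodMk_left
    have hq : ∀ {f : EuclideanSpace ℝ (Fin n) → ℝ}, Measurable f →
        Measurable fun p : (Fin k → ℝ) × ℝ =>
          G (Fin.snoc p.1 (f (A.query ⟨k, h⟩ (s, p.1)) + p.2)) := fun hf =>
      hG.comp ((measurable_finSnoc k).comp (measurable_fst.prodMk
        ((hf.comp (measurable_subtype_coe.comp ((A.measurable_query ⟨k, h⟩).comp
          (measurable_const.prodMk measurable_fst)))).add measurable_snd)))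
    rw [lintegral_pi_finSnoc _ (G := fun w => G (A.prefixAnswers f s (k + 1) h w))
        (hG.comp (hp hf)),
      lintegral_pi_finSnoc _ (G := fun w => G (A.prefixAnswers g s (k + 1) h w) ^ 2)
        ((hG.comp (hp hg)).pow_const 2)]
    simp only [A.prefixAnswers_snoc]
    -- The induction hypothesis is applied to `G` with the last noise integrated out. The next query
    -- is then the same function of the earlier answers for `f` and `g`, so the one-answer bound
    -- contributes one more factor `C`.
    refine (ih hk (hq hf).lintegral_prod_right').trans ?_
    rw [pow_succ, mul_assoc]
    gcongr
    rw [← lintegral_const_mul]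
    · refine lintegral_mono fun w => ?_
      exact sq_lintegral_add_gaussianReal_le (hfg _) hv (h := fun t => G (Fin.snoc _ t))
        (hG.comp ((measurable_finSnoc k).comp measurable_prodMk_left))
    · exact ((hq hg).pow_const 2).lintegral_prod_right'.comp
        ((A.measurable_prefixAnswers hg k hk).comp measurable_prodMk_left)

open ProbabilityTheory in
theorem Method.measureReal_estimate_mem_le {f g : EuclideanSpace ℝ (Fin n) → ℝ}
    (hf : Measurable f) (hg : Measurable g) {Δ : ℝ} (hfg : ∀ x, |f x - g x| ≤ Δ) {v : NNReal}
    (hv : v ≠ 0) (s : A.Seed) {S : Set (EuclideanSpace ℝ (Fin n))} (hS : MeasurableSet S) :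
    (Measure.pi fun _ => gaussianReal 0 v).real {w | A.estimate f s w ∈ S} ^ 2 ≤
      Real.exp (T * Δ ^ 2 / v) *
        (Measure.pi fun _ => gaussianReal 0 v).real {w | A.estimate g s w ∈ S} := by
  set P : Measure (Fin T → ℝ) := Measure.pi fun _ => gaussianReal 0 v
  have ho : Measurable fun a : Fin T → ℝ => (A.output (s, a) : EuclideanSpace ℝ (Fin n)) :=
    measurable_subtype_coe.comp (A.measurable_output.comp measurable_prodMk_left)
  set G : (Fin T → ℝ) → ENNReal := Set.indicator {a | (A.output (s, a) : EuclideanSpace ℝ (Fin n)) ∈ S} 1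
  have hG : Measurable G := measurable_one.indicator (ho hS)
  -- An indicator is its own square, so the second moment on the right is a probability.
  have hG2 : ∀ a, G a ^ 2 = G a := by
    intro a
    by_cases h : (A.output (s, a) : EuclideanSpace ℝ (Fin n)) ∈ S <;> simp [G, h]
  have hE : ∀ {f : EuclideanSpace ℝ (Fin n) → ℝ}, Measurable f →
      ∫⁻ w, G (A.prefixAnswers f s T le_rfl w) ∂P = P {w | A.estimate f s w ∈ S} := by
    intro f hf
    have hm : MeasurableSet {w | A.estimate f s w ∈ S} :=
      (A.measurable_estimate hf).comp measurable_prodMk_left hS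
    rw [← lintegral_indicator_one hm]
    refine lintegral_congr fun w => ?_
    simp only [G, Method.estimate, A.answers_eq_prefixAnswers]
    rfl
  have key := A.sq_lintegral_prefixAnswers_le hf hg hfg hv s T le_rfl hG
  simp only [hG2] at key
  rw [hE hf, hE hg] at key
  have := ENNReal.toReal_mono (by finiteness) key
  rw [ENNReal.toReal_mul, ENNReal.toReal_pow, ENNReal.toReal_pow,
    ENNReal.toReal_ofReal (Real.exp_pos _).le, ← Real.exp_nat_mul, ← mul_div_assoc] at this
  exact this

end DFO

/-! ### Sign vectors -/

/-- The unit vector all of whose coordinates are `± 1 / √n`, with the signs given by `b`. -/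
def signVector {n : ℕ} (b : Fin n → Bool) : EuclideanSpace ℝ (Fin n) :=
  WithLp.toLp 2 fun i => bif b i then 1 / √n else -(1 / √n)

theorem norm_signVector {n : ℕ} (hn : 0 < n) (b : Fin n → Bool) : ‖signVector b‖ = 1 := by
  have hn' : (n : ℝ) ≠ 0 := by positivity
  have h : ∀ i, (signVector b i) ^ 2 = 1 / n := by
    intro i
    simp only [signVector]
    cases b i <;> simp [Real.sq_sqrt]
  have : ‖signVector b‖ ^ 2 = 1 := by
    rw [EuclideanSpace.real_norm_sq_eq]
    simp [h, hn']
  exact (pow_eq_one_iff_of_nonneg (norm_nonneg _) two_ne_zero).1 this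

/-- The sum factors over coordinates into terms `2 cosh (√n z_i)`, and `cosh t ≤ exp (t² / 2)`. -/
theorem sum_exp_inner_signVector_le {n : ℕ} (hn : 0 < n) (z : EuclideanSpace ℝ (Fin n)) :
    ∑ b : Fin n → Bool, Real.exp (n * inner ℝ (signVector b) z) ≤
      2 ^ n * Real.exp (n * ‖z‖ ^ 2 / 2) := by
  have hn' : (n : ℝ) ≠ 0 := by positivity
  have hs : (n : ℝ) * (1 / √n) = √n := by
    rw [mul_one_div, Real.div_sqrt]
  have e : ∀ b : Fin n → Bool, Real.exp (n * inner ℝ (signVector b) z) =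
      ∏ i, Real.exp ((bif b i then √n else -√n) * z i) := by
    intro b
    rw [← Real.exp_sum]
    congr 1
    rw [PiLp.inner_apply, Finset.mul_sum]
    refine Finset.sum_congr rfl fun i _ => ?_
    simp only [signVector, RCLike.inner_apply, conj_trivial]
    cases b i
    · simp only [cond_false]
      linear_combination -z i * hs
    · simp only [cond_true]
      linear_combination z i * hs
  simp only [e]
  rw [← Fintype.piFinset_univ, ← Finset.prod_univ_sum (fun _ => Finset.univ)
    fun i (c : Bool) => Real.exp ((bif c then √n else -√n) * z i)]
  calc _ ≤ ∏ i : Fin n, (2 * Real.exp (n * z i ^ 2 / 2)) := by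
        refine Finset.prod_le_prod (fun i _ => Finset.sum_nonneg fun _ _ => (Real.exp_pos _).le)
          fun i _ => ?_
        have := Real.cosh_le_exp_half_sq (√n * z i)
        rw [Real.cosh_eq, mul_pow, Real.sq_sqrt (Nat.cast_nonneg n)] at this
        rw [Fintype.sum_bool, cond_true, cond_false, neg_mul]
        linarith
    _ = _ := by
        rw [Finset.prod_mul_distrib, ← Real.exp_sum, EuclideanSpace.real_norm_sq_eq,
          Finset.mul_sum, Finset.sum_div]
        simp

/-- Few sign vectors are close to a given point. -/
theorem card_norm_sub_signVector_lt_le {n : ℕ} (hn : 0 < n) (z : EuclideanSpace ℝ (Fin n)) :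
    ((Finset.univ.filter fun b : Fin n → Bool => ‖z - signVector b‖ < 1 / 2).card : ℝ) ≤
      2 ^ n * Real.exp (-(3 * n / 8)) := by
  -- Chernoff bound: closeness forces an inner product of at least `‖z‖² / 2 + 3/8`. The `‖z‖²` term
  -- cancels against the moment bound, leaving an estimate uniform in `z`.
  have h : ∀ b ∈ Finset.univ.filter fun b : Fin n → Bool => ‖z - signVector b‖ < 1 / 2,
      Real.exp (n * ‖z‖ ^ 2 / 2 + 3 * n / 8) ≤ Real.exp (n * inner ℝ (signVector b) z) := by
    intro b hb
    rw [Finset.mem_filter] at hb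
    have h1 : ‖z - signVector b‖ ^ 2 ≤ (1 / 2) ^ 2 := by gcongr; exact hb.2.le
    rw [norm_sub_sq_real, norm_signVector hn, real_inner_comm] at h1
    have h2 : (0 : ℝ) ≤ n := Nat.cast_nonneg n
    refine Real.exp_le_exp.2 ?_
    nlinarith [mul_le_mul_of_nonneg_left h1 h2]
  have h2 := (Finset.card_nsmul_le_sum _ _ _ h).trans
    ((Finset.sum_le_univ_sum_of_nonneg fun b => (Real.exp_pos _).le).trans
      (sum_exp_inner_signVector_le hn z))
  rw [nsmul_eq_mul, Real.exp_add, mul_comm (Real.exp _), ← mul_assoc] at h2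
  have h3 := le_of_mul_le_mul_right h2 (Real.exp_pos _)
  rw [Real.exp_neg, ← div_eq_mul_inv, le_div_iff₀ (Real.exp_pos _)]
  exact h3

theorem sum_measureReal_le_of_card_le {Ω ι : Type*} [MeasurableSpace Ω] [Fintype ι]
    (P : Measure Ω) [IsProbabilityMeasure P] {E : ι → Set Ω} (hE : ∀ i, MeasurableSet (E i))
    [∀ w, DecidablePred fun i => w ∈ E i] {K : ℝ}
    (hK : ∀ w, ((Finset.univ.filter fun i => w ∈ E i).card : ℝ) ≤ K) :
    ∑ i, P.real (E i) ≤ K := by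
  calc ∑ i, P.real (E i) = ∑ i, ∫ w, (E i).indicator 1 w ∂P := by
        simp only [integral_indicator_one (hE _)]
    _ = ∫ w, ∑ i, (E i).indicator 1 w ∂P := by
        rw [integral_finsetSum]
        exact fun i _ => (integrable_const (1 : ℝ)).indicator (hE i)
    _ ≤ ∫ _, K ∂P := by
        refine integral_mono (integrable_finsetSum _ fun i _ =>
          (integrable_const (1 : ℝ)).indicator (hE i)) (integrable_const K) fun w => ?_
        refine le_of_eq_of_le ?_ (hK w)
        simp [Set.indicator_apply]
    _ = K := by simp

/-! ### Averaging over the hidden direction -/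

namespace DFO

open ProbabilityTheory in
theorem isNoiseLaw_gaussianReal (σ : ℝ) : IsNoiseLaw σ (gaussianReal 0 (Real.toNNReal (σ ^ 2))) where
  isProbabilityMeasure := inferInstance
  memLp := memLp_id_gaussianReal 2
  mean := integral_id_gaussianReal
  second_moment := by
    have h := variance_fun_id_gaussianReal (μ := 0) (v := Real.toNNReal (σ ^ 2))
    rw [variance_of_integral_eq_zero (by fun_prop) integral_id_gaussianReal] at h
    rw [h, Real.coe_toNNReal _ (sq_nonneg σ)]

variable {n : ℕ} {B : Set (EuclideanSpace ℝ (Fin n))} {T : ℕ} (A : Method.{u} B T)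

open ProbabilityTheory in
open scoped Classical in
theorem Method.sum_measureReal_estimate_near_le (hn : 8 ≤ n)
    {f : (Fin n → Bool) → EuclideanSpace ℝ (Fin n) → ℝ} {g : EuclideanSpace ℝ (Fin n) → ℝ}
    (hf : ∀ b, Measurable (f b)) (hg : Measurable g) {Δ : ℝ} (hfg : ∀ b x, |f b x - g x| ≤ Δ)
    {v : NNReal} (hv : v ≠ 0) (hT : T * Δ ^ 2 / v ≤ n / 8) (s : A.Seed)
    (x₀ : EuclideanSpace ℝ (Fin n)) {a : ℝ} (ha : 0 < a) :
    ∑ b, (Measure.pi fun _ => gaussianReal 0 v).real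
      {w | A.estimate (f b) s w ∈ Metric.ball (x₀ + a • signVector b) (a / 2)} ≤ 2 ^ n / 2 := by
  set P : Measure (Fin T → ℝ) := Measure.pi fun _ => gaussianReal 0 v
  have hn0 : 0 < n := by omega
  -- Under `g` a single estimate serves all `b`, so the events are counted outcome by outcome after
  -- rescaling by `a`.
  have hq : ∑ b : Fin n → Bool, P.real
      {w | A.estimate g s w ∈ Metric.ball (x₀ + a • signVector b) (a / 2)} ≤
        2 ^ n * Real.exp (-(3 * n / 8)) := by
    refine sum_measureReal_le_of_card_le P
      (fun b => ((A.measurable_estimate hg).comp measurable_prodMk_left) Metric.isOpen_ball.measurableSet)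
      fun w => ?_
    refine le_trans ?_ (card_norm_sub_signVector_lt_le hn0 (a⁻¹ • (A.estimate g s w - x₀)))
    refine Nat.cast_le.2 (Finset.card_le_card fun b hb => ?_)
    simp only [Finset.mem_filter, Finset.mem_univ, true_and] at hb ⊢
    replace hb : ‖A.estimate g s w - (x₀ + a • signVector b)‖ < a / 2 := mem_ball_iff_norm.1 hb
    have e : a⁻¹ • (A.estimate g s w - x₀) - signVector b =
        a⁻¹ • (A.estimate g s w - (x₀ + a • signVector b)) := by
      rw [← sub_sub, smul_sub a⁻¹ (A.estimate g s w - x₀), smul_smul, inv_mul_cancel₀ ha.ne',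
        one_smul]
    rw [e, norm_smul, norm_inv, Real.norm_eq_abs, abs_of_pos ha, inv_mul_lt_iff₀ ha]
    linarith
  refine le_of_abs_le (abs_le_of_sq_le_sq ?_ (by positivity))
  calc _ ≤ (2 : ℝ) ^ n * ∑ b : Fin n → Bool, P.real
        {w | A.estimate (f b) s w ∈ Metric.ball (x₀ + a • signVector b) (a / 2)} ^ 2 := by
        refine (sq_sum_le_card_mul_sum_sq (s := Finset.univ)).trans_eq ?_
        simp
    _ ≤ 2 ^ n * ∑ b : Fin n → Bool, Real.exp (n / 8) * P.real
        {w | A.estimate g s w ∈ Metric.ball (x₀ + a • signVector b) (a / 2)} := by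
        gcongr with b
        refine (A.measureReal_estimate_mem_le (hf b) hg (hfg b) hv s
          Metric.isOpen_ball.measurableSet).trans ?_
        gcongr
    _ ≤ 2 ^ n * (Real.exp (n / 8) * (2 ^ n * Real.exp (-(3 * n / 8)))) := by
        rw [← Finset.mul_sum]
        gcongr
    _ = (2 ^ n) ^ 2 * Real.exp (-(n / 4)) := by
        rw [mul_left_comm (Real.exp _), ← Real.exp_add, ← mul_assoc, ← sq]
        congr 2
        ring
    _ ≤ (2 ^ n) ^ 2 * (1 / 4) := by
        gcongr
        have h8 : (8 : ℝ) ≤ n := by exact_mod_cast hn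
        have h1 : 4 ≤ Real.exp (n / 4) := by
          have h2 : Real.exp 2 ≤ Real.exp (n / 4) := Real.exp_le_exp.2 (by linarith)
          have h3 : Real.exp 2 = Real.exp 1 ^ 2 := by rw [← Real.exp_nat_mul]; norm_num
          nlinarith [Real.add_one_le_exp 1]
        rw [Real.exp_neg, one_div]
        gcongr
    _ = (2 ^ n / 2) ^ 2 := by ring

open ProbabilityTheory in
/-- If every function of a family indexed by sign vectors exceeds its infimum by a fixed gap
outside a small ball around `x₀ + a • signVector b`, and if the functions are too close to a
common function to be told apart from `T` noisy evaluations, then no method has an expected error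
below half the gap on all of them. -/
theorem Method.half_gap_le_of_expectedError_le (hn : 8 ≤ n)
    {f : (Fin n → Bool) → EuclideanSpace ℝ (Fin n) → ℝ} {g : EuclideanSpace ℝ (Fin n) → ℝ}
    (hf : ∀ b, Measurable (f b)) (hg : Measurable g) {Δ : ℝ} (hfg : ∀ b x, |f b x - g x| ≤ Δ)
    {v : NNReal} (hv : v ≠ 0) (hT : T * Δ ^ 2 / v ≤ n / 8)
    (x₀ : EuclideanSpace ℝ (Fin n)) {a : ℝ} (ha : 0 < a) {δ : ℝ}
    (hgap : ∀ b x, x ∉ Metric.ball (x₀ + a • signVector b) (a / 2) →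
      δ ≤ f b x - sInf (f b '' B)) {S : ENNReal}
    (hS : ∀ b, A.expectedError (f b) (gaussianReal 0 v) ≤ S) :
    ENNReal.ofReal (δ / 2) ≤ S := by
  set P : Measure (Fin T → ℝ) := Measure.pi fun _ => gaussianReal 0 v
  set E : (Fin n → Bool) → A.Seed → Set (Fin T → ℝ) := fun b s =>
    {w | A.estimate (f b) s w ∈ Metric.ball (x₀ + a • signVector b) (a / 2)}
  have hE : ∀ b s, MeasurableSet (E b s) := fun b s =>
    ((A.measurable_estimate (hf b)).comp measurable_prodMk_left) Metric.isOpen_ball.measurableSet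
  -- For each fixed seed the failure probability averages at least `1/2`, so randomization cannot
  -- help.
  have hsum : ∀ s, ENNReal.ofReal (2 ^ n / 2) ≤ ∑ b, P (E b s)ᶜ := by
    intro s
    have h := A.sum_measureReal_estimate_near_le hn hf hg hfg hv hT s x₀ ha
    have e : ∑ b, P (E b s)ᶜ = ENNReal.ofReal (∑ b, (1 - P.real (E b s))) := by
      rw [ENNReal.ofReal_sum_of_nonneg fun b _ => sub_nonneg.2 measureReal_le_one]
      refine Finset.sum_congr rfl fun b _ => ?_
      rw [← probReal_compl_eq_one_sub (hE b s), ofReal_measureReal]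
    rw [e, Finset.sum_sub_distrib]
    refine ENNReal.ofReal_le_ofReal ?_
    simp only [Finset.sum_const, Finset.card_univ, Fintype.card_fun, Fintype.card_bool,
      Fintype.card_fin, nsmul_eq_mul, Nat.cast_pow, Nat.cast_ofNat, mul_one]
    linarith
  have hm : ∀ b, Measurable fun p : A.Seed × (Fin T → ℝ) =>
      ENNReal.ofReal (f b (A.estimate (f b) p.1 p.2) - sInf (f b '' B)) := fun b =>
    (((hf b).comp (A.measurable_estimate (hf b))).sub_const _).ennreal_ofReal
  have hkey : ENNReal.ofReal δ * ENNReal.ofReal (2 ^ n / 2) ≤ 2 ^ n * S := by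
    calc ENNReal.ofReal δ * ENNReal.ofReal (2 ^ n / 2)
        = ∫⁻ _, ENNReal.ofReal δ * ENNReal.ofReal (2 ^ n / 2) ∂A.seedLaw := by simp
      _ ≤ ∫⁻ s, ∑ b, ∫⁻ w, ENNReal.ofReal
            (f b (A.estimate (f b) s w) - sInf (f b '' B)) ∂P ∂A.seedLaw := by
          refine lintegral_mono fun s => ?_
          refine (mul_le_mul_right (hsum s) _).trans ?_
          rw [Finset.mul_sum]
          refine Finset.sum_le_sum fun b _ => ?_
          rw [← setLIntegral_const]
          refine (setLIntegral_mono' (hE b s).compl fun w hw => ?_).trans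
            (setLIntegral_le_lintegral _ _)
          exact ENNReal.ofReal_le_ofReal (hgap b _ hw)
      _ = ∑ b, A.expectedError (f b) (gaussianReal 0 v) := by
          rw [lintegral_finsetSum _ fun b _ => (hm b).lintegral_prod_right']
          refine Finset.sum_congr rfl fun b _ => ?_
          rw [Method.expectedError, lintegral_prod _ (hm b).aemeasurable]
      _ ≤ ∑ _b : Fin n → Bool, S := Finset.sum_le_sum fun b _ => hS b
      _ = 2 ^ n * S := by simp
  have h2 : ENNReal.ofReal δ * ENNReal.ofReal (2 ^ n / 2) = 2 ^ n * ENNReal.ofReal (δ / 2) := by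
    rw [← ENNReal.ofReal_mul' (by positivity), show (2 : ENNReal) ^ n = ENNReal.ofReal (2 ^ n) by
      rw [ENNReal.ofReal_pow zero_le_two]; norm_num, ← ENNReal.ofReal_mul (by positivity)]
    congr 1
    ring
  rw [h2] at hkey
  exact (ENNReal.mul_le_mul_iff_right (by simp) (by finiteness)).1 hkey

end DFO

end

/-! ### Choice of the parameters -/

theorem theorem3 (τ L : ℝ) (hτ : 0 < τ) (hτL : τ < L) :
    ∃ c : ℝ, 0 < c ∧
      ∀ (n : ℕ), 8 ≤ n →
      ∀ (B : Set (EuclideanSpace ℝ (Fin n))), Convex ℝ B → (interior B).Nonempty →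
      ∀ (σ : ℝ), 0 < σ →
      ∀ᶠ T : ℕ in atTop,
        ENNReal.ofReal (c * √(n * σ ^ 2 / T)) ≤ DFO.minimaxError.{u} τ L σ B T := by
  obtain ⟨μ, κ, hκ, hκμ, rfl, rfl⟩ : ∃ μ κ : ℝ, 0 < κ ∧ κ < μ ∧ μ - κ = τ ∧ μ + κ = L :=
    ⟨(L + τ) / 2, (L - τ) / 2, by linarith, by linarith, by ring, by ring⟩
  have hμ : 0 < μ := hκ.trans hκμ
  refine ⟨(μ - κ) * κ / (16 * μ ^ 2) / √8, by positivity, ?_⟩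
  intro n hn B hB hBi σ hσ
  obtain ⟨x₀, hx₀⟩ := hBi
  obtain ⟨ρ, hρ, hball⟩ := Metric.isOpen_iff.1 isOpen_interior x₀ hx₀
  -- Beyond `0 < T`, largeness of `T` serves only to place all the minimizers in a ball around `x₀`
  -- inside `B`.
  have hlim : Tendsto (fun T : ℕ => √(σ / κ * √(n / 8 / T)) * (κ / μ)) atTop (nhds 0) := by
    have h := tendsto_const_div_atTop_nhds_zero_nat ((n : ℝ) / 8)
    simpa using! (((h.sqrt).const_mul (σ / κ)).sqrt).mul_const (κ / μ)
  filter_upwards [hlim.eventually_lt_const hρ, eventually_gt_atTop 0] with T hTρ hT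
  have hT' : (0 : ℝ) < T := by exact_mod_cast hT
  have hn' : (0 : ℝ) < n := by exact_mod_cast (show 0 < n by omega)
  set q := √(n / 8 / T)
  have hq : 0 < q := Real.sqrt_pos.2 (by positivity)
  -- The largest scale allowed by the information budget: `T * (κ * r ^ 2) ^ 2 / σ ^ 2` is exactly
  -- `n / 8`.
  set r := √(σ / κ * q)
  have hr : 0 < r := Real.sqrt_pos.2 (by positivity)
  have hr2 : r ^ 2 = σ / κ * q := Real.sq_sqrt (by positivity)
  have hu := fun b : Fin n → Bool => norm_signVector (by omega : 0 < n) b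
  have hmem : ∀ b : Fin n → Bool, x₀ + (r * (κ / μ)) • signVector b ∈ B := fun b =>
    interior_subset (hball (by
      rw [Metric.mem_ball, dist_self_add_left, norm_smul, hu, mul_one, Real.norm_eq_abs,
        abs_of_pos (by positivity)]
      exact hTρ))
  have hfmem := fun b => DFO.tiltedQuadratic_mem_functionClass hκ.le hκμ hr (hu b) hB ⟨x₀, hx₀⟩
    (hmem b)
  refine le_iInf fun A => ?_
  set v := Real.toNNReal (σ ^ 2)
  have hv : (v : ℝ) = σ ^ 2 := Real.coe_toNNReal _ (sq_nonneg σ)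
  have hv0 : v ≠ 0 := (Real.toNNReal_pos.2 (by positivity)).ne'
  have hΔ : T * (κ * r ^ 2) ^ 2 / v ≤ (n : ℝ) / 8 := by
    rw [hv, hr2, show κ * (σ / κ * q) = σ * q by field_simp, mul_pow,
      Real.sq_sqrt (by positivity)]
    apply le_of_eq
    field_simp
  refine le_trans (ENNReal.ofReal_le_ofReal (le_of_eq ?_))
    (A.half_gap_le_of_expectedError_le hn (f := fun b => DFO.tiltedQuadratic μ κ r x₀ (signVector b))
      (g := fun x => μ / 2 * ‖x - x₀‖ ^ 2)
      (fun b => DFO.continuous_tiltedQuadratic.measurable) (by fun_prop)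
      (fun b => DFO.abs_tiltedQuadratic_sub_le hκ.le) hv0 hΔ x₀ (a := r * (κ / μ)) (by positivity)
      (δ := (μ - κ) / 2 * (r * (κ / μ) / 2) ^ 2) (fun b x hx => ?_) (fun b => ?_))
  · have e : √(n * σ ^ 2 / T) = √8 * (σ * q) := by
      rw [show n * σ ^ 2 / T = 8 * (σ ^ 2 * (n / 8 / T)) by field_simp,
        Real.sqrt_mul (by norm_num), Real.sqrt_mul (by positivity), Real.sqrt_sq hσ.le]
    rw [e, div_pow, mul_pow, hr2]
    field_simp
    norm_num
  · refine le_trans ?_ (DFO.tiltedQuadratic_sub_sInf_ge hκ.le hκμ hr.ne' (hu b) (hmem b) x)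
    rw [Metric.mem_ball, not_lt, dist_eq_norm] at hx
    have : 0 ≤ (μ - κ) / 2 := by linarith
    gcongr
  · exact le_iSup₂_of_le _ (hfmem b) (le_iSup₂_of_le _ (DFO.isNoiseLaw_gaussianReal σ) le_rfl)
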